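/- Let $p,m,n$ be nonnegative integers with $p\le m\le n$. Consider networks of $n$ agents $x_1,\dots,x_n$ and $m$ observers $y_1,\dots,y_m$: a directed graph on the agents in which every agent has a self-loop, together with edges from agents to observers such that each observer measures exactly one agent and no two observers measure the same agent. Such a network is encoded by structural matrices $[A]$ ($n\times n$) and $[C]$ ($m\times n$): the entry $A_{ij}$ is a free real parameter if there is an edge $x_j\to x_i$ and is fixed to be $0$ otherwise; similarly $C_{ij}$ is free if there is an edge $x_j\to y_i$ and is $0$ otherwise. Let $\|A\|_0$ be the number of free entries of $[A]$ (self-loops included). An attack on a set $F$ of agents adds one input $u_f$ for each $f\in F$, acting on the agent $f$ only; this gives a structural matrix $[B^a]$ of size $n\times|F|$. Observers are not attacked, so $D^a=0$. A system $x(k+1)=Ax(k)+B^au(k)$, $y(k)=Cx(k)$ is left invertible if, with $x(0)=0$, $y(k)=0$ for all $k\ge 0$ implies $u(k)=0$ for all $k\ge 0$. The structural system $([A],[B^a],[C])$ is structurally left invertible if its realizations are left invertible for all values of the free parameters outside a set of Lebesgue measure zero. Theorem. The minimum of $\|A\|_0$ over all networks $([A],[C])$ as above for which $([A],[B^a],[C])$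 is structurally left invertible for every set $F$ of at most $p$ attacked agents exists and equals $$\|A\|_0^*=(n-m)p+n.$$ Moreover, the minimum is attained by every network in which each unobserved agent has exactly $p$ edges to observed agents, a self-loop, and no other outgoing edges, and each observed agent has no outgoing edges besides its self-loop and the edge to its observer; such networks exist for every choice of the $m$ observed agents. -/

import Mathlib

open MeasureTheory

namespace DCS

/-- A structural matrix `[M]` with rows `ι` and columns `κ`, given by the set of its nonzero
positions: `(i, j) ∈ S` means that `M i j` is a free real parameter, and `(i, j) ∉ S` means that
`M i j` is fixed to be `0`. -/
abbrev StructMat (ι κ : Type) : Type := Finset (ι × κ)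

namespace StructMat

/-- The free parameters of a structural matrix. -/
abbrev Free {ι κ : Type} (S : StructMat ι κ) : Type := {q : ι × κ // q ∈ S}

/-- The admissible realization of a structural matrix with the given parameter values. -/
def realize {ι κ : Type} [DecidableEq ι] [DecidableEq κ] (S : StructMat ι κ) (r : S.Free → ℝ) :
    Matrix ι κ ℝ :=
  fun i j => if h : (i, j) ∈ S then r ⟨(i, j), h⟩ else 0

/-- The number `‖M‖₀` of nonzero positions of a structural matrix. -/
def l0 {ι κ : Type} (S : StructMat ι κ) : ℕ := S.card

end StructMat

/-- Left invertibility of `x(k+1) = A x(k) + B u(k)`, `y(k) = C x(k) + D u(k)`: with `x(0) = 0`,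
`y(k) = 0` for all `k` implies `u(k) = 0` for all `k`. -/
def LeftInvertible {ι κ υ : Type} [Fintype ι] [Fintype υ]
    (A : Matrix ι ι ℝ) (B : Matrix ι υ ℝ) (C : Matrix κ ι ℝ) (D : Matrix κ υ ℝ) : Prop :=
  ∀ (u : ℕ → υ → ℝ) (x : ℕ → ι → ℝ), x 0 = 0 →
    (∀ k, x (k + 1) = A.mulVec (x k) + B.mulVec (u k)) →
    (∀ k, C.mulVec (x k) + D.mulVec (u k) = 0) →
    ∀ k, u k = 0

/-- Structural left invertibility of `([A], [B], [C], [D])`: all admissible realizations are left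
invertible, except for a set of parameter values of Lebesgue measure zero. -/
def StructurallyLeftInvertible {ι κ υ : Type} [Fintype ι] [Fintype κ] [Fintype υ]
    [DecidableEq ι] [DecidableEq κ] [DecidableEq υ]
    (A : StructMat ι ι) (B : StructMat ι υ) (C : StructMat κ ι) (D : StructMat κ υ) : Prop :=
  ∀ᵐ r : A.Free ⊕ B.Free ⊕ C.Free ⊕ D.Free → ℝ,
    LeftInvertible (A.realize fun q => r (.inl q)) (B.realize fun q => r (.inr (.inl q)))
      (C.realize fun q => r (.inr (.inr (.inl q)))) (D.realize fun q => r (.inr (.inr (.inr q))))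

/-- A network of `n` agents and `m` observers, i.e. a choice of `([A], [C])`. Each observer measures
exactly one agent, no two observers measure the same agent, and every agent has a self-loop. -/
structure Network (n m : ℕ) where
  /-- The structural matrix `[A]`: `(i, j) ∈ A` iff there is an edge from agent `j` to agent `i`. -/
  A : StructMat (Fin n) (Fin n)
  /-- The agent measured by each observer. -/
  obs : Fin m ↪ Fin n
  selfLoop : ∀ i, (i, i) ∈ A

namespace Network

variable {n m : ℕ}

/-- The structural observation matrix `[C]`: row `j` has its only nonzero entry in the column of the
agent measured by observer `j`. -/
def C (N : Network n m) : StructMat (Fin m) (Fin n) :=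
  Finset.univ.image fun j => (j, N.obs j)

/-- Agent `i` is observed. -/
def Observed (N : Network n m) (i : Fin n) : Prop := ∃ j, N.obs j = i

/-- The agents, possibly `i` itself, that receive an edge from agent `i`. -/
def outNbrs (N : Network n m) (i : Fin n) : Finset (Fin n) :=
  Finset.univ.filter fun k => (k, i) ∈ N.A

/-- The minimal layout: each unobserved agent has exactly `p` edges to observed agents and a
self-loop and no other edges; among agents, an observed agent has an edge only to itself. -/
def IsMinimalLayout (N : Network n m) (p : ℕ) : Prop :=
  (∀ i, ¬ N.Observed i →
    ∃ T : Finset (Fin n), (∀ k ∈ T, N.Observed k) ∧ T.card = p ∧ N.outNbrs i = insert i T) ∧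
  ∀ i, N.Observed i → N.outNbrs i = {i}

end Network

/-- The structural attack matrix `[Bᵃ]` for a set `F` of compromised agents: one attack input for
each compromised agent, acting on that agent only. -/
def attackB {n : ℕ} (F : Finset (Fin n)) : StructMat (Fin n) {i // i ∈ F} :=
  Finset.univ.image fun f => (f.1, f)

/-- The network is structurally left invertible for every attack on at most `p` agents; observers
are not attacked, so `[Dᵃ] = 0`. -/
def Network.SecureAgainstAgents {n m : ℕ} (N : Network n m) (p : ℕ) : Prop :=
  ∀ F : Finset (Fin n), F.card ≤ p →
    StructurallyLeftInvertible N.A (attackB F) N.C (∅ : StructMat (Fin m) {i // i ∈ F})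

end DCS

/-! Count edges by their tails. If an unobserved agent `i` has at most `p` out-neighbours, itself
included, attack exactly those: excite `i` once, then cancel column `i` of `A` one step later. The
state lives on `i` alone, so no observer reacts; hence unobserved agents need out-degree at least `p
+ 1`, and self-loops give the rest of the bound. In a minimal layout, zero output kills the observed
states, and unattacked unobserved agents hear only themselves, so stay at zero. By Hall, the
attacked unobserved agents are matched to unattacked observed out-neighbours, whose update equations
form a generically nonsingular square system. So the state vanishes, and then so does the input. -/

namespace DCS

/-! ### Generic nonsingularity -/

namespace StructMat

variable {ι κ : Type} [DecidableEq ι] [DecidableEq κ]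

theorem realize_of_mem (S : StructMat ι κ) (r : S.Free → ℝ) {i : ι} {j : κ} (h : (i, j) ∈ S) :
    S.realize r i j = r ⟨(i, j), h⟩ := dif_pos h

theorem realize_of_notMem (S : StructMat ι κ) (r : S.Free → ℝ) {i : ι} {j : κ}
    (h : (i, j) ∉ S) : S.realize r i j = 0 := dif_neg h

theorem realize_empty (r : (∅ : StructMat ι κ).Free → ℝ) :
    (∅ : StructMat ι κ).realize r = 0 := by
  ext i j
  exact realize_of_notMem _ _ (Finset.notMem_empty _)

theorem continuous_realize_apply (S : StructMat ι κ) (i : ι) (j : κ) :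
    Continuous fun r : S.Free → ℝ => S.realize r i j := by
  by_cases h : (i, j) ∈ S
  · simpa only [S.realize_of_mem _ h] using continuous_apply _
  · simpa only [S.realize_of_notMem _ h] using continuous_const

/-- A square submatrix of a structural matrix whose diagonal consists of free parameters is
generically nonsingular: along the direction `w` that adds a multiple of the identity to this
submatrix, its determinant is a characteristic polynomial, which has finitely many roots. -/
theorem ae_det_submatrix_ne_zero {α τ : Type} [Fintype α] [DecidableEq α] [Fintype τ]
    (S : StructMat ι κ) (e : S.Free → τ) (he : Function.Injective e)
    (f : α → ι) (g : α → κ) (hf : Function.Injective f) (hg : Function.Injective g)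
    (hfg : ∀ a, (f a, g a) ∈ S) :
    ∀ᵐ r : τ → ℝ, ((S.realize fun q => r (e q)).submatrix f g).det ≠ 0 := by
  classical
  let w : τ → ℝ := fun t => if ∃ a, e ⟨(f a, g a), hfg a⟩ = t then 1 else 0
  have hw : (S.realize fun q => w (e q)).submatrix f g = 1 := by
    ext a b
    rcases eq_or_ne a b with rfl | hab
    · simp only [Matrix.submatrix_apply, S.realize_of_mem _ (hfg a), Matrix.one_apply_eq, w]
      exact if_pos ⟨a, rfl⟩
    · rw [Matrix.submatrix_apply, Matrix.one_apply_ne hab]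
      by_cases h : (f a, g b) ∈ S
      · rw [S.realize_of_mem _ h]
        refine if_neg ?_
        rintro ⟨c, hc⟩
        have hc := congrArg Subtype.val (he hc)
        rw [Prod.mk.injEq] at hc
        exact hab ((hf hc.1).symm.trans (hg hc.2))
      · exact S.realize_of_notMem _ h
  have hline : ∀ (r : τ → ℝ) (t : ℝ), (S.realize fun q => (r + t • w) (e q)).submatrix f g =
      Matrix.scalar α t - -(S.realize fun q => r (e q)).submatrix f g := by
    intro r t
    have : (S.realize fun q => (r + t • w) (e q)).submatrix f g =
        (S.realize fun q => r (e q)).submatrix f g +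
          t • (S.realize fun q => w (e q)).submatrix f g := by
      ext a b
      by_cases h : (f a, g b) ∈ S <;> simp [realize, h]
    rw [this, hw, sub_neg_eq_add, add_comm, Matrix.smul_one_eq_diagonal, Matrix.scalar_apply]
  have hcont : Continuous fun r : τ → ℝ =>
      ((S.realize fun q => r (e q)).submatrix f g).det := by
    refine Continuous.matrix_det (continuous_matrix fun a b => ?_)
    exact (S.continuous_realize_apply (f a) (g b)).comp
      (f := fun (r : τ → ℝ) q => r (e q)) (continuous_pi fun q => continuous_apply (e q))
  -- Fubini: it suffices that each line in direction `w` avoids the set only on a null set.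
  refine ae_mem_of_ae_add_linearMap_mem (LinearMap.toSpanSingleton ℝ (τ → ℝ) w) volume volume
    (s := {r : τ → ℝ | ((S.realize fun q => r (e q)).submatrix f g).det ≠ 0})
    (isOpen_ne_fun hcont continuous_const).measurableSet fun r => ?_
  have hfin : {t : ℝ | (-(S.realize fun q => r (e q)).submatrix f g).charpoly.IsRoot t}.Finite :=
    Polynomial.finite_setOfPred_isRoot (Matrix.charpoly_monic _).ne_zero
  filter_upwards [measure_eq_zero_iff_ae_notMem.1 (hfin.measure_zero volume)] with t ht
  simp only [Polynomial.IsRoot.def, Matrix.eval_charpoly] at ht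
  simpa only [Set.mem_ofPred_eq, LinearMap.toSpanSingleton_apply, hline] using ht

end StructMat

theorem mem_attackB {n : ℕ} {F : Finset (Fin n)} {i : Fin n} {f : {i // i ∈ F}} :
    (i, f) ∈ attackB F ↔ i = f := by
  simp [attackB, eq_comm]

theorem attackB_mulVec_of_notMem {n : ℕ} {F : Finset (Fin n)} (r : (attackB F).Free → ℝ)
    (v : {i // i ∈ F} → ℝ) {i : Fin n} (hi : i ∉ F) :
    ((attackB F).realize r).mulVec v i = 0 := by
  rw [Matrix.mulVec, dotProduct]
  refine Finset.sum_eq_zero fun f _ => ?_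
  rw [StructMat.realize_of_notMem, zero_mul]
  rw [mem_attackB]
  rintro rfl
  exact hi f.2

theorem attackB_mulVec_apply {n : ℕ} {F : Finset (Fin n)} (r : (attackB F).Free → ℝ)
    (v : {i // i ∈ F} → ℝ) (f : {i // i ∈ F}) :
    ((attackB F).realize r).mulVec v f = r ⟨(f, f), mem_attackB.2 rfl⟩ * v f := by
  rw [Matrix.mulVec, dotProduct]
  refine (Finset.sum_eq_single f (fun g _ hg => ?_) (by simp)).trans ?_
  · rw [StructMat.realize_of_notMem, zero_mul]
    rw [mem_attackB]
    exact fun h => hg (Subtype.ext h.symm)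
  · rw [StructMat.realize_of_mem]

namespace Network

variable {n m : ℕ} (N : Network n m)

theorem mem_outNbrs {i k : Fin n} : k ∈ N.outNbrs i ↔ (k, i) ∈ N.A := by
  simp [outNbrs]

theorem mem_C {j : Fin m} {i : Fin n} : (j, i) ∈ N.C ↔ N.obs j = i := by
  simp only [C, Finset.mem_image, Finset.mem_univ, true_and, Prod.mk.injEq]
  exact ⟨by rintro ⟨_, rfl, h⟩; exact h, fun h => ⟨j, rfl, h⟩⟩

theorem C_mulVec_apply (r : N.C.Free → ℝ) (v : Fin n → ℝ) (j : Fin m) :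
    (N.C.realize r).mulVec v j = r ⟨(j, N.obs j), N.mem_C.2 rfl⟩ * v (N.obs j) := by
  rw [Matrix.mulVec, dotProduct]
  refine (Finset.sum_eq_single (N.obs j) (fun i _ hi => ?_) (by simp)).trans ?_
  · rw [StructMat.realize_of_notMem, zero_mul]
    rw [mem_C]
    exact hi.symm
  · rw [StructMat.realize_of_mem]

/-! ### Edge count and lower bound -/

theorem l0_eq_sum_card_outNbrs : N.A.l0 = ∑ i, (N.outNbrs i).card := by
  classical
  rw [StructMat.l0, Finset.card_eq_sum_card_fiberwise (f := Prod.snd) (t := Finset.univ)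
    (fun _ _ => Finset.mem_univ _)]
  refine Finset.sum_congr rfl fun i _ => Finset.card_nbij' Prod.fst (fun k => (k, i)) ?_ ?_ ?_ ?_
  · rintro ⟨k, l⟩ h
    obtain ⟨hA, rfl : l = i⟩ := Finset.mem_filter.1 (Finset.mem_coe.1 h)
    exact Finset.mem_coe.2 (N.mem_outNbrs.2 hA)
  · intro k h
    exact Finset.mem_filter.2 ⟨N.mem_outNbrs.1 h, rfl⟩
  · rintro ⟨k, l⟩ h
    obtain ⟨hA, rfl : l = i⟩ := Finset.mem_filter.1 h
    rfl
  · exact fun _ _ => rfl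

open Classical in
theorem sum_ite_observed (p : ℕ) :
    ∑ i, ((if N.Observed i then 0 else p) + 1) = (n - m) * p + n := by
  have hobs : (Finset.univ.filter N.Observed).card = m := by
    have : Finset.univ.filter N.Observed = Finset.univ.map N.obs := by
      ext i
      simp [Observed]
    rw [this, Finset.card_map, Finset.card_fin]
  have hun : (Finset.univ.filter fun i => ¬ N.Observed i).card = n - m := by
    rw [Finset.filter_not, Finset.card_sdiff_of_subset (Finset.filter_subset _ _), hobs,
      Finset.card_fin]
  rw [Finset.sum_add_distrib, Finset.sum_ite, Finset.sum_const_zero, zero_add, Finset.sum_const,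
    hun]
  simp

/-- In a secure network an unobserved agent has at least `p` edges to other agents: otherwise an
attack on it and on its out-neighbours can excite it for one time step unnoticed. -/
theorem SecureAgainstAgents.lt_card_outNbrs {N : Network n m} {p : ℕ}
    (hN : N.SecureAgainstAgents p) {i : Fin n} (hi : ¬ N.Observed i) :
    p < (N.outNbrs i).card := by
  by_contra! hp
  have hF := hN (N.outNbrs i) hp
  have hiF : i ∈ N.outNbrs i := N.mem_outNbrs.2 (N.selfLoop i)
  -- A full-measure set is dense, so some left invertible realization has all free parameters
  -- nonzero.
  obtain ⟨r, hr0, hr⟩ := (Measure.dense_of_ae hF).inter_open_nonempty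
    (Set.univ.pi fun _ => {0}ᶜ) (isOpen_set_pi Set.finite_univ fun _ _ => isOpen_compl_singleton)
    ⟨1, by simp⟩
  have hr0 : ∀ q, r q ≠ 0 := fun q => hr0 q (Set.mem_univ q)
  set A := N.A.realize fun q => r (.inl q) with hA
  let b : {k // k ∈ N.outNbrs i} → ℝ := fun f => r (.inr (.inl ⟨(f, f), mem_attackB.2 rfl⟩))
  have hb : ∀ f, b f ≠ 0 := fun f => hr0 _
  -- The desired values of `B u`, supported on the attacked set.
  let v : ℕ → Fin n → ℝ
    | 0 => Pi.single i 1
    | 1 => -A.col i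
    | _ => 0
  let x : ℕ → Fin n → ℝ
    | 1 => Pi.single i 1
    | _ => 0
  let u : ℕ → {k // k ∈ N.outNbrs i} → ℝ := fun k f => v k f / b f
  have hB : ∀ k, ((attackB (N.outNbrs i)).realize fun q => r (.inr (.inl q))).mulVec (u k) =
      v k := by
    intro k
    ext j
    by_cases hj : j ∈ N.outNbrs i
    · exact (attackB_mulVec_apply _ _ ⟨j, hj⟩).trans (mul_div_cancel₀ _ (hb ⟨j, hj⟩))
    · rw [attackB_mulVec_of_notMem _ _ hj]
      have hji : j ≠ i := by
        rintro rfl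
        exact hj hiF
      match k with
      | 0 => exact (Pi.single_eq_of_ne (M := fun _ => ℝ) hji 1).symm
      | 1 =>
        change 0 = -A j i
        rw [hA, StructMat.realize_of_notMem _ _ fun h => hj (N.mem_outNbrs.2 h), neg_zero]
      | k + 2 => rfl
  have hu := congrFun (hr u x rfl (fun k => ?_) (fun k => ?_) 0) ⟨i, hiF⟩
  · refine div_ne_zero ?_ (hb ⟨i, hiF⟩) hu
    change (Pi.single i 1 : Fin n → ℝ) i ≠ 0
    simp
  · rw [hB]
    match k with
    | 0 => simp [x, v]
    | 1 => simp [x, v, A]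
    | k + 2 => simp [x, v]
  · ext j
    rw [Pi.add_apply, C_mulVec_apply, StructMat.realize_empty, Matrix.zero_mulVec, Pi.zero_apply,
      add_zero]
    have hx : x k (N.obs j) = 0 := by
      match k with
      | 0 => rfl
      | 1 => exact Pi.single_eq_of_ne (M := fun _ => ℝ) (fun h => hi ⟨j, h⟩) 1
      | k + 2 => rfl
    rw [hx, mul_zero]

theorem SecureAgainstAgents.le_l0 {N : Network n m} {p : ℕ} (hN : N.SecureAgainstAgents p) :
    (n - m) * p + n ≤ N.A.l0 := by
  classical
  rw [l0_eq_sum_card_outNbrs, ← N.sum_ite_observed p]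
  refine Finset.sum_le_sum fun i _ => ?_
  split_ifs with hi
  · exact Finset.card_pos.2 ⟨i, N.mem_outNbrs.2 (N.selfLoop i)⟩
  · exact hN.lt_card_outNbrs hi

/-! ### Security of minimal layouts -/

namespace IsMinimalLayout

variable {N} {p : ℕ}

theorem l0_eq (hN : N.IsMinimalLayout p) : N.A.l0 = (n - m) * p + n := by
  classical
  rw [l0_eq_sum_card_outNbrs, ← N.sum_ite_observed p]
  refine Finset.sum_congr rfl fun i _ => ?_
  split_ifs with hi
  · rw [hN.2 i hi, Finset.card_singleton]
  · obtain ⟨T, hT, hTp, hi'⟩ := hN.1 i hi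
    rw [hi', Finset.card_insert_of_notMem fun h => hi (hT i h), hTp]

theorem observed_of_mem (hN : N.IsMinimalLayout p) {i k : Fin n} (h : (k, i) ∈ N.A)
    (hki : k ≠ i) : ¬ N.Observed i ∧ N.Observed k := by
  rw [← mem_outNbrs] at h
  by_cases hi : N.Observed i
  · rw [hN.2 i hi, Finset.mem_singleton] at h
    exact absurd h hki
  · obtain ⟨T, hT, -, hi'⟩ := hN.1 i hi
    rw [hi'] at h
    exact ⟨hi, hT k (Finset.mem_of_mem_insert_of_ne h hki)⟩

/-- The unobserved attacked agents can be matched to observed agents that are not attacked. -/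
theorem exists_matching (hN : N.IsMinimalLayout p) {F : Finset (Fin n)} (hF : F.card ≤ p) :
    ∃ f : {i // i ∈ F ∧ ¬ N.Observed i} → Fin n, Function.Injective f ∧
      ∀ a, (f a, a.1) ∈ N.A ∧ N.Observed (f a) ∧ f a ∉ F := by
  classical
  choose T hT hTp hTN using fun a : {i // i ∈ F ∧ ¬ N.Observed i} => hN.1 a a.2.2
  obtain ⟨f, hf, hfT⟩ := (Finset.all_card_le_biUnion_card_iff_exists_injective
    (fun a => T a \ F)).1 fun s => by
      rcases s.eq_empty_or_nonempty with rfl | ⟨a, ha⟩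
      · simp
      -- One neighbourhood suffices for Hall: `T a` has `p ≥ F.card` elements and loses at most the
      -- observed members of `F`, which leaves at least as many as `F` has unobserved members.
      refine le_trans ?_ (Finset.card_le_card (Finset.subset_biUnion_of_mem _ ha))
      have h1 : s.card ≤ (F.filter fun i => ¬ N.Observed i).card := by
        rw [← Finset.card_map (Function.Embedding.subtype _)]
        refine Finset.card_le_card fun i hi => ?_
        obtain ⟨c, -, rfl⟩ := Finset.mem_map.1 hi
        exact Finset.mem_filter.2 c.2
      have h2 : (T a ∩ F).card ≤ (F.filter N.Observed).card :=
        Finset.card_le_card fun i hi => by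
          rw [Finset.mem_inter] at hi
          exact Finset.mem_filter.2 ⟨hi.2, hT a i hi.1⟩
      have h3 := Finset.card_filter_add_card_filter_not (s := F) N.Observed
      have h4 := Finset.card_sdiff_add_card_inter (T a) F
      have h5 := hTp a
      omega
  refine ⟨f, hf, fun a => ?_⟩
  have h := Finset.mem_sdiff.1 (hfT a)
  exact ⟨N.mem_outNbrs.1 (hTN a ▸ Finset.mem_insert_of_mem h.1), hT a _ h.1, h.2⟩

theorem secureAgainstAgents (hN : N.IsMinimalLayout p) : N.SecureAgainstAgents p := by
  classical
  intro F hF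
  obtain ⟨f, hf, hfN⟩ := hN.exists_matching hF
  filter_upwards [N.A.ae_det_submatrix_ne_zero
      (Sum.inl : _ → N.A.Free ⊕ (attackB F).Free ⊕ N.C.Free ⊕ StructMat.Free ∅) Sum.inl_injective
      f Subtype.val hf Subtype.val_injective fun a => (hfN a).1,
    ae_all_iff.2 fun q => Measure.ae_eval_ne (μ := fun _ => volume) q 0] with r hdet hr u x hx0 hx hy
  set A := N.A.realize fun q => r (.inl q) with hA
  have hobs : ∀ i, N.Observed i → ∀ k, x k i = 0 := by
    rintro _ ⟨j, rfl⟩ k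
    have h := congrFun (hy k) j
    rw [Pi.add_apply, C_mulVec_apply, StructMat.realize_empty, Matrix.zero_mulVec, Pi.zero_apply,
      add_zero, mul_eq_zero] at h
    exact h.resolve_left (hr _)
  have hunatt : ∀ i, i ∉ F → ∀ k, x k i = 0 := by
    intro i hi k
    by_cases hio : N.Observed i
    · exact hobs i hio k
    induction k with
    | zero => rw [hx0, Pi.zero_apply]
    | succ k ih =>
      rw [hx, Pi.add_apply, attackB_mulVec_of_notMem _ _ hi, add_zero, Matrix.mulVec, dotProduct]
      refine Finset.sum_eq_zero fun j _ => ?_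
      rcases eq_or_ne i j with rfl | hij
      · rw [ih, mul_zero]
      · rw [hA, StructMat.realize_of_notMem _ _ fun h => hio (hN.observed_of_mem h hij).2, zero_mul]
  have hatt : ∀ k, (fun a : {i // i ∈ F ∧ ¬ N.Observed i} => x k a) = 0 := by
    intro k
    refine Matrix.eq_zero_of_mulVec_eq_zero hdet ?_
    ext a
    -- Agent `f a` is observed and unattacked, so its update says that row `f a` of `A` annihilates
    -- `x k`; only attacked unobserved columns contribute.
    have h := congrFun (hx k) (f a)
    rw [hobs _ (hfN a).2.1, Pi.add_apply, attackB_mulVec_of_notMem _ _ (hfN a).2.2, add_zero] at h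
    rw [Pi.zero_apply, h, Matrix.mulVec, dotProduct, Matrix.mulVec, dotProduct]
    refine Fintype.sum_of_injective Subtype.val Subtype.val_injective _ _ (fun i hi => ?_)
      fun _ => rfl
    have : x k i = 0 := by
      by_cases hio : N.Observed i
      · exact hobs i hio k
      · exact hunatt i (fun hiF => hi ⟨⟨i, hiF, hio⟩, rfl⟩) k
    rw [this, mul_zero]
  have hxk : ∀ k, x k = 0 := by
    intro k
    ext i
    by_cases hio : N.Observed i
    · exact hobs i hio k
    by_cases hiF : i ∈ F
    · exact congrFun (hatt k) ⟨i, hiF, hio⟩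
    · exact hunatt i hiF k
  intro k
  ext g
  have h := congrFun (hx k) g
  rw [hxk, hxk, Matrix.mulVec_zero, zero_add, attackB_mulVec_apply, Pi.zero_apply, eq_comm,
    mul_eq_zero] at h
  exact h.resolve_left (hr _)

end IsMinimalLayout

theorem exists_isMinimalLayout {p : ℕ} (hpm : p ≤ m) (obs : Fin m ↪ Fin n) :
    ∃ N : Network n m, N.obs = obs ∧ N.IsMinimalLayout p := by
  classical
  -- All unobserved agents can share one target set.
  obtain ⟨T, hT, hTp⟩ := Finset.exists_subset_card_eq
    (s := Finset.univ.map obs) (n := p) (by simpa using hpm)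
  have hTobs : ∀ k ∈ T, ∃ j, obs j = k := fun k hk => by simpa using hT hk
  refine ⟨⟨Finset.univ.filter fun q => q.1 = q.2 ∨ (¬ ∃ j, obs j = q.2) ∧ q.1 ∈ T, obs,
    by simp⟩, rfl, fun i hi => ⟨T, hTobs, hTp, ?_⟩, fun i hi => ?_⟩
  · ext k
    have hi : ¬ ∃ j, obs j = i := hi
    rw [mem_outNbrs, Finset.mem_filter, Finset.mem_insert]
    exact ⟨fun h => h.2.imp_right And.right, fun h => ⟨Finset.mem_univ _, h.imp_right (⟨hi, ·⟩)⟩⟩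
  · ext k
    have hi : ∃ j, obs j = i := hi
    rw [mem_outNbrs, Finset.mem_filter, Finset.mem_singleton]
    exact ⟨fun h => h.2.resolve_right fun h => h.1 hi, fun h => ⟨Finset.mem_univ _, .inl h⟩⟩

end Network

end DCS

theorem mainTheorem4 (n m p : ℕ) (hpm : p ≤ m) (hmn : m ≤ n) :
    IsLeast {c : ℕ | ∃ N : DCS.Network n m, N.SecureAgainstAgents p ∧ N.A.l0 = c}
      ((n - m) * p + n) ∧
    (∀ N : DCS.Network n m, N.IsMinimalLayout p →
      N.SecureAgainstAgents p ∧ N.A.l0 = (n - m) * p + n) ∧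
    (∀ obs : Fin m ↪ Fin n, ∃ N : DCS.Network n m, N.obs = obs ∧ N.IsMinimalLayout p) := by
  refine ⟨⟨?_, ?_⟩, fun N hN => ⟨hN.secureAgainstAgents, hN.l0_eq⟩,
    DCS.Network.exists_isMinimalLayout hpm⟩
  · obtain ⟨N, -, hN⟩ := DCS.Network.exists_isMinimalLayout hpm (Fin.castLEEmb hmn)
    exact ⟨N, hN.secureAgainstAgents, hN.l0_eq⟩
  · rintro _ ⟨N, hN, rfl⟩
    exact hN.le_l0
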